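/- Let $n\ge 0$ be an integer, $\mu>0$, and let $(\Omega,\mathcal F,(\mathcal F_t)_{t\ge 0},\mathbb P)$ be a filtered probability space carrying two adapted point processes $A(t)$ (arrivals) and $D(t)$ (retrial instants), which almost surely have no common jump, and $n$ independent Poisson processes $\pi_1,\dots,\pi_n$ of rate $\mu$ with respect to $(\mathcal F_t)$ (each is adapted, and its increment over $(s,t]$ is Poisson with mean $\mu(t-s)$ and independent of $\mathcal F_s$). Point processes start at $0$, are right-continuous and have jumps of size one. Assume that $A(t)/t\to\lambda$ almost surely as $t\to\infty$, for a constant $\lambda$. Consider the $n$-server queue with one orbit place, retrials and losses: $Q_1(t)\in\{0,\dots,n\}$ (the number of busy servers), $Q_2(t)\in\{0,1\}$ (the orbit state) and $Q_3(t)\in\{0,1,2,\dots\}$ (the number of losses up to time $t$) are adapted processes such that almost surely, for all $t\ge0$, $$Q_1(t)+Q_2(t)+Q_3(t)=A(t)-\int_0^t\sum_{l=1}^n\mathbf 1\{Q_1(s-)\ge l\}\,d\pi_l(s),$$ $$Q_2(t)+Q_3(t)=\int_0^t\mathbf 1\{Q_1(s-)=n\}\,dA(s)-\int_0^t\mathbf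 1\{Q_1(s-)\ne n\}\,\mathbf 1\{Q_2(s-)=1\}\,dD(s),$$ $$Q_3(t)=\int_0^t\mathbf 1\{Q_1(s-)=n\}\,\mathbf 1\{Q_2(s-)=1\}\,dA(s).$$ Then almost surely every path of $Q_1$ is integrable on bounded time intervals, the random variables $\int_0^tQ_1(s)\,ds$ are integrable, and the following hold, where $\mathbb P\text{-}\lim$ denotes the limit in probability as $t\to\infty$. 1. Without any assumption on the existence of limits, $\mathbb P\text{-}\lim_{t\to\infty}\Big(\dfrac{Q_3(t)}t+\dfrac{\mu}{t}\displaystyle\int_0^tQ_1(s)\,ds\Big)=\lambda.$ 2. For every (possibly random) real $X$, $\mathbb P\text{-}\lim\frac1t\int_0^tQ_1(s)\,ds=X$ if and only if $\mathbb P\text{-}\lim\frac{Q_3(t)}t=\lambda-\mu X$. 3. Whenever the loss rate $\mathbb P\text{-}\lim_{t\to\infty}Q_3(t)/t$ exists as a constant (by 2, equivalently, whenever $\mathbb P\text{-}\lim\frac1t\int_0^tQ_1(s)\,ds$ exists as a constant), all the limits below exist and $$\mathbb P\text{-}\lim_{t\to\infty}\frac{Q_3(t)}t=\lambda-\mu\Big(\mathbb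 P\text{-}\lim_{t\to\infty}\frac1t\int_0^tQ_1(s)\,ds\Big)=\lambda-\mu\Big(\lim_{t\to\infty}\frac1t\,\mathbb E\int_0^tQ_1(s)\,ds\Big).$$ -/

import Mathlib

open MeasureTheory ProbabilityTheory Filter Topology
open scoped NNReal ENNReal

namespace RetrialQueue

/-- The path of a (simple) point process: it starts at `0`, is nondecreasing and
right-continuous, and all its jumps have size one. The values being integers, such a path has
finitely many jumps in every bounded time interval. -/
structure IsCountingPath (a : ℝ≥0 → ℕ) : Prop where
  zero : a 0 = 0
  mono : Monotone a
  rightCont : ∀ t, ContinuousWithinAt a (Set.Ici t) t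
  jump_le_one : ∀ t, a t ≤ Function.leftLim a t + 1

/-- The jump `a(t) - a(t-)`; it is `0` at `t = 0`. -/
noncomputable def jump (a : ℝ≥0 → ℕ) (t : ℝ≥0) : ℝ :=
  (a t : ℝ) - ((Function.leftLim a t : ℕ) : ℝ)

/-- The Stieltjes integral `∫_0^t f(s) da(s)` over `(0,t]` against the path `a` of a point process,
that is, the sum of `f(s) (a(s) - a(s-))` over the finitely many jump times `s ∈ (0,t]` of `a`. -/
noncomputable def pathIntegral (f : ℝ≥0 → ℝ) (a : ℝ≥0 → ℕ) (t : ℝ≥0) : ℝ :=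
  ∑ᶠ s ∈ Set.Ioc (0 : ℝ≥0) t, f s * jump a s

/-- The number of departures (service completions) up to time `t`,
`C(t) = ∫_0^t ∑_{l=1}^n 1{Q₁(s-) ≥ l} dπ_l(s)`. The index `l : Fin n` stands for server number
`l + 1`, so that `1{Q₁(s-) ≥ l + 1}` is `1{l < Q₁(s-)}`. -/
noncomputable def departures {n : ℕ} (p : Fin n → ℝ≥0 → ℕ) (q₁ : ℝ≥0 → ℕ) (t : ℝ≥0) : ℝ :=
  ∑ l : Fin n, pathIntegral (fun s => if (l : ℕ) < Function.leftLim q₁ s then 1 else 0) (p l) t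

/-- The pathwise dynamics of the queue with `n` servers, one orbit place and losses, driven by the
arrival path `a`, the path `d` of retrial instants and the paths `p l` of service instants.
`q₁` is the number of busy servers, `q₂` the orbit occupancy, `q₃` the cumulated number of losses.
The system is empty at time `0`. -/
structure IsQueuePath {n : ℕ} (a d : ℝ≥0 → ℕ) (p : Fin n → ℝ≥0 → ℕ)
    (q₁ q₂ q₃ : ℝ≥0 → ℕ) : Prop where
  /-- There are `n` servers. -/
  servers : ∀ t, q₁ t ≤ n
  /-- There is one place in the orbit. -/
  orbit : ∀ t, q₂ t ≤ 1
  /-- Customers in service, in orbit and lost: all arrivals minus the departures. -/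
  balance : ∀ t, (q₁ t : ℝ) + q₂ t + q₃ t = a t - departures p q₁ t
  /-- In orbit or lost: arrivals that find all servers busy, minus the successful retrials. -/
  orbit_or_lost : ∀ t, (q₂ t : ℝ) + q₃ t =
    pathIntegral (fun s => if Function.leftLim q₁ s = n then 1 else 0) a t
      - pathIntegral
          (fun s => if Function.leftLim q₁ s ≠ n ∧ Function.leftLim q₂ s = 1 then 1 else 0) d t
  /-- Lost: arrivals that find all servers busy and the orbit place occupied. -/
  lost : ∀ t, (q₃ t : ℝ) =
    pathIntegral
      (fun s => if Function.leftLim q₁ s = n ∧ Function.leftLim q₂ s = 1 then 1 else 0) a t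

variable {Ω : Type*} [mΩ : MeasurableSpace Ω]

/-- A point process on the filtered probability space `(Ω, 𝓕, P)`. -/
structure IsPointProcess (P : Measure Ω) (𝓕 : Filtration ℝ≥0 mΩ) (N : ℝ≥0 → Ω → ℕ) : Prop where
  adapted : Adapted 𝓕 N
  path : ∀ᵐ ω ∂P, IsCountingPath (fun t => N t ω)

/-- A Poisson process of rate `μ` on the filtered probability space `(Ω, 𝓕, P)`: an adapted point
process whose increment over `(s,t]` is Poisson with mean `μ (t - s)` and independent of `𝓕 s`. -/
structure IsPoissonProcess (P : Measure Ω) (𝓕 : Filtration ℝ≥0 mΩ) (μ : ℝ≥0)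
    (N : ℝ≥0 → Ω → ℕ) : Prop extends IsPointProcess P 𝓕 N where
  increment_law : ∀ s t, s ≤ t → P.map (fun ω => N t ω - N s ω) = poissonMeasure (μ * (t - s))
  increment_indep : ∀ s t, s ≤ t →
    Indep (MeasurableSpace.comap (fun ω => N t ω - N s ω) ⊤) (𝓕 s) P

/-- Almost surely, the two point processes have no common jump time. -/
def NoCommonJumps (P : Measure Ω) (M N : ℝ≥0 → Ω → ℕ) : Prop :=
  ∀ᵐ ω ∂P, ∀ t, jump (fun s => M s ω) t = 0 ∨ jump (fun s => N s ω) t = 0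

/-- The cumulated busy time of the servers, `∫_0^t Q₁(s) ds`. -/
noncomputable def busyTime (Q₁ : ℝ≥0 → Ω → ℕ) (t : ℝ≥0) (ω : Ω) : ℝ :=
  ∫ s in (0 : ℝ)..t, (Q₁ s.toNNReal ω : ℝ)

end RetrialQueue

/-! ### Step functions on the half-line -/

namespace RetrialQueue

/-! Let `C` be the departure process and `M(t) = C(t) - μ ∫_0^t Q₁`. The balance equation reads
`Q₃/t + μ (∫_0^t Q₁)/t = A/t - M/t - (Q₁ + Q₂)/t`. Here `A/t → λ`, and the last term is at most `(n
+ 1)/t`, so everything reduces to `M(t)/t → 0` in probability.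

Since `Q₁` is the sum of the indicators `1{Q₁ > l}`, `M` is a sum of `n` integrals of left limits of
adapted indicators against compensated Poisson processes (`departures_sub_busyTime`). Each has
second moment at most `μ t`, and Chebyshev's inequality concludes. The moment bound is proved by
hand: on a grid the integral is a sum of orthogonal terms (`integral_sq_sum_le`), the grid sums
converge along almost every path (`ae_tendsto_compensatedIntegral`), and Fatou's lemma carries the
bound to the limit. Pathwise convergence needs `Q₁` to be a step function, which the queue equations
force (`IsQueuePath.isStep_servers`).

The equivalence of the two limits is then linear algebra, and the convergence of means is bounded
convergence, as `0 ≤ Q₁ ≤ n`. -/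

/-- A right-continuous step function with left limits: it is locally constant on both sides of
every point. -/
structure IsStep {α : Type*} (g : ℝ≥0 → α) : Prop where
  left : ∀ t, ∃ c, ∀ᶠ s in 𝓝[<] t, g s = c
  right : ∀ t, ∀ᶠ s in 𝓝[>] t, g s = g t

namespace IsStep

variable {α β γ : Type*} {g : ℝ≥0 → α}

theorem comp (hg : IsStep g) (φ : α → β) : IsStep (fun t => φ (g t)) where
  left t := (hg.left t).imp' φ fun _ h => h.mono fun _ hs => congrArg φ hs
  right t := (hg.right t).mono fun _ hs => congrArg φ hs

theorem comp₂ {h : ℝ≥0 → β} (hg : IsStep g) (hh : IsStep h) (φ : α → β → γ) :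
    IsStep (fun t => φ (g t) (h t)) where
  left t := by
    obtain ⟨c, hc⟩ := hg.left t
    obtain ⟨d, hd⟩ := hh.left t
    exact ⟨φ c d, by filter_upwards [hc, hd] with s h1 h2; rw [h1, h2]⟩
  right t := by filter_upwards [hg.right t, hh.right t] with s h1 h2; rw [h1, h2]

theorem of_comp_injective {φ : α → β} (hφ : φ.Injective) (hg : IsStep (fun t => φ (g t))) :
    IsStep g where
  left t := by
    obtain ⟨c, hc⟩ := hg.left t
    -- At `t = 0` the left neighbourhood filter is trivial and any constant serves.
    rcases (𝓝[<] t).eq_or_neBot with hb | hb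
    · exact ⟨g t, by simp [hb]⟩
    · obtain ⟨s, hs⟩ := hc.exists
      exact ⟨g s, hc.mono fun r hr => hφ (hr.trans hs.symm)⟩
  right t := (hg.right t).mono fun _ hs => hφ hs

theorem eventually_locally_const (hg : IsStep g) (t : ℝ≥0) :
    ∀ᶠ s in 𝓝[≠] t, ∀ᶠ r in 𝓝 s, g r = g s := by
  rw [← Set.Iio_union_Ioi, nhdsWithin_union, eventually_sup]
  constructor
  · obtain ⟨c, hc⟩ := hg.left t
    filter_upwards [eventually_eventually_nhdsWithin.2 hc, hc, self_mem_nhdsWithin] with s h1 h2 h3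
    rw [IsOpen.nhdsWithin_eq isOpen_Iio h3] at h1
    exact h1.mono fun r hr => hr.trans h2.symm
  · filter_upwards [eventually_eventually_nhdsWithin.2 (hg.right t), hg.right t,
      self_mem_nhdsWithin] with s h1 h2 h3
    rw [IsOpen.nhdsWithin_eq isOpen_Ioi h3] at h1
    exact h1.mono fun r hr => hr.trans h2.symm

theorem eventually_eq_leftLim [TopologicalSpace α] [T2Space α] (hg : IsStep g) (t : ℝ≥0) :
    ∀ᶠ s in 𝓝[<] t, g s = Function.leftLim g t := by
  rcases (𝓝[<] t).eq_or_neBot with hb | hb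
  · simp [hb]
  · obtain ⟨c, hc⟩ := hg.left t
    have : Tendsto g (𝓝[<] t) (𝓝 c) := tendsto_const_nhds.congr' (hc.mono fun _ h => h.symm)
    rwa [leftLim_eq_of_tendsto this]

/-- No continuity of `φ` is needed: a step function attains its left limit just before `t`. -/
theorem leftLim_comp [TopologicalSpace α] [T2Space α] [TopologicalSpace β] [T2Space β]
    (hg : IsStep g) (φ : α → β) {t : ℝ≥0} :
    Function.leftLim (fun s => φ (g s)) t = φ (Function.leftLim g t) := by
  rcases (𝓝[<] t).eq_or_neBot with hb | hb
  · rw [leftLim_eq_of_eq_bot _ hb, leftLim_eq_of_eq_bot _ hb]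
  · obtain ⟨s, h1, h2⟩ :=
      ((hg.eventually_eq_leftLim t).and ((hg.comp φ).eventually_eq_leftLim t)).exists
    rw [← h2, h1]

theorem eventually_leftLim_eq [TopologicalSpace α] [T2Space α] (hg : IsStep g) (t : ℝ≥0) :
    ∀ᶠ s in 𝓝[≠] t, Function.leftLim g s = g s := by
  filter_upwards [hg.eventually_locally_const t] with s hs
  refine ContinuousWithinAt.leftLim_eq (ContinuousAt.continuousWithinAt ?_)
  exact tendsto_const_nhds.congr' (hs.mono fun _ h => h.symm)

end IsStep

/-! ### Counting paths and integrals against them -/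

namespace IsCountingPath

variable {a : ℝ≥0 → ℕ}

theorem isStep (ha : IsCountingPath a) : IsStep a where
  left t := by
    have := ha.mono.tendsto_leftLim t
    rw [nhds_discrete, tendsto_pure] at this
    exact ⟨_, this⟩
  right t := by
    have := ha.rightCont t
    rw [ContinuousWithinAt, nhds_discrete, tendsto_pure] at this
    exact this.filter_mono (nhdsWithin_mono _ Set.Ioi_subset_Ici_self)

theorem eventually_jump_eq_zero (ha : IsCountingPath a) (t : ℝ≥0) :
    ∀ᶠ s in 𝓝[≠] t, jump a s = 0 := by
  filter_upwards [ha.isStep.eventually_leftLim_eq t] with s hs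
  rw [jump, hs, sub_self]

/-- Each point has a neighbourhood with no other jump; by compactness, the centres of a finite
subcover contain all jumps. Without finiteness the `finsum` in `pathIntegral` could take its default
value `0`. -/
theorem finite_jumps (ha : IsCountingPath a) (u v : ℝ≥0) :
    (Set.Ioc u v ∩ Function.support (jump a)).Finite := by
  obtain ⟨F, -, hF⟩ := (isCompact_Icc (a := u) (b := v)).elim_nhds_subcover
    (fun x => {s | s ≠ x → jump a s = 0})
    (fun x _ => eventually_nhdsWithin_iff.1 (ha.eventually_jump_eq_zero x))
  refine F.finite_toSet.subset fun s hs => ?_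
  obtain ⟨x, hx, hsx⟩ := Set.mem_iUnion₂.1 (hF (Set.Ioc_subset_Icc_self hs.1))
  by_contra hne
  exact hs.2 (hsx fun h => hne (h ▸ hx))

theorem finite_support_mul_jump (ha : IsCountingPath a) (f : ℝ≥0 → ℝ) (u v : ℝ≥0) :
    (Set.Ioc u v ∩ Function.support (fun s => f s * jump a s)).Finite :=
  (ha.finite_jumps u v).subset
    (Set.inter_subset_inter_right _ (Function.support_mul_subset_right f (jump a)))

theorem pathIntegral_eq_add (ha : IsCountingPath a) (f : ℝ≥0 → ℝ) {u v : ℝ≥0} (huv : u ≤ v) :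
    pathIntegral f a v = pathIntegral f a u + ∑ᶠ s ∈ Set.Ioc u v, f s * jump a s := by
  rw [pathIntegral, pathIntegral, ← Set.Ioc_union_Ioc_eq_Ioc (zero_le (a := u)) huv]
  exact finsum_mem_union' (Set.Ioc_disjoint_Ioc_of_le le_rfl) (ha.finite_support_mul_jump f _ _)
    (ha.finite_support_mul_jump f _ _)

theorem eventually_pathIntegral_right (ha : IsCountingPath a) (f : ℝ≥0 → ℝ) (t : ℝ≥0) :
    ∀ᶠ s in 𝓝[>] t, pathIntegral f a s = pathIntegral f a t := by
  have h := (ha.eventually_jump_eq_zero t).filter_mono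
    (nhdsWithin_mono t fun s (hs : t < s) => hs.ne')
  obtain ⟨r, hr, hsub⟩ := mem_nhdsGT_iff_exists_Ioo_subset.1 h
  filter_upwards [Ioo_mem_nhdsGT hr] with s hs
  rw [ha.pathIntegral_eq_add f hs.1.le, finsum_mem_eq_zero_of_forall_eq_zero, add_zero]
  intro x hx
  have : jump a x = 0 := hsub ⟨hx.1, hx.2.trans_lt hs.2⟩
  rw [this, mul_zero]

theorem eventually_pathIntegral_left (ha : IsCountingPath a) (f : ℝ≥0 → ℝ) (t : ℝ≥0) :
    ∀ᶠ s in 𝓝[<] t, pathIntegral f a t = pathIntegral f a s + f t * jump a t := by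
  rcases eq_zero_or_pos t with rfl | ht
  · simp
  have h := (ha.eventually_jump_eq_zero t).filter_mono
    (nhdsWithin_mono t fun s (hs : s < t) => hs.ne)
  obtain ⟨r, hr, hsub⟩ := (mem_nhdsLT_iff_exists_Ioo_subset' ht).1 h
  filter_upwards [Ioo_mem_nhdsLT hr] with s hs
  rw [ha.pathIntegral_eq_add f hs.2.le]
  congr 1
  rw [← finsum_mem_singleton (f := fun s => f s * jump a s) (a := t)]
  refine finsum_mem_inter_support_eq' _ _ _ fun x hx => ?_
  have hx : f x * jump a x ≠ 0 := hx
  constructor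
  · intro hxt
    by_contra hne
    have : jump a x = 0 := hsub ⟨hs.1.trans hxt.1, lt_of_le_of_ne hxt.2 hne⟩
    exact hx (by rw [this, mul_zero])
  · rintro rfl
    exact ⟨hs.2, le_rfl⟩

theorem isStep_pathIntegral (ha : IsCountingPath a) (f : ℝ≥0 → ℝ) :
    IsStep (pathIntegral f a) where
  left t := ⟨pathIntegral f a t - f t * jump a t,
    (ha.eventually_pathIntegral_left f t).mono fun s hs => by rw [hs]; ring⟩
  right t := ha.eventually_pathIntegral_right f t

/-- Both sides have the same jumps, so their difference is locally constant on a connected space,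
and it vanishes at `0`. -/
theorem pathIntegral_one (ha : IsCountingPath a) (t : ℝ≥0) :
    pathIntegral (fun _ => 1) a t = a t := by
  have hloc : IsLocallyConstant (fun s => pathIntegral (fun _ => 1) a s - a s) := by
    rw [IsLocallyConstant.iff_eventually_eq]
    intro t
    rw [← nhdsNE_sup_pure, ← Set.Iio_union_Ioi, nhdsWithin_union, eventually_sup, eventually_sup]
    refine ⟨⟨?_, ?_⟩, by simp⟩
    · filter_upwards [ha.eventually_pathIntegral_left (fun _ => 1) t,
        ha.isStep.eventually_eq_leftLim t] with s h1 h2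
      rw [h1, jump, h2]
      ring
    · filter_upwards [ha.eventually_pathIntegral_right (fun _ => 1) t, ha.isStep.right t]
        with s h1 h2
      rw [h1, h2]
  have := hloc.apply_eq_of_preconnectedSpace t 0
  simp only [pathIntegral, ha.zero, Set.Ioc_self, Set.mem_empty_iff_false] at this ⊢
  simp at this ⊢
  linarith

theorem finsum_jump (ha : IsCountingPath a) {u v : ℝ≥0} (huv : u ≤ v) :
    ∑ᶠ s ∈ Set.Ioc u v, jump a s = a v - a u := by
  have := ha.pathIntegral_eq_add (fun _ => 1) huv
  simp only [ha.pathIntegral_one, one_mul] at this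
  linarith

theorem pathIntegral_add_of_const (ha : IsCountingPath a) {f : ℝ≥0 → ℝ} {u v : ℝ≥0} (huv : u ≤ v)
    {c : ℝ} (hf : ∀ s ∈ Set.Ioc u v, f s = c) :
    pathIntegral f a v = pathIntegral f a u + c * (a v - a u) := by
  rw [ha.pathIntegral_eq_add f huv, ← ha.finsum_jump huv, mul_finsum_mem]
  exact congrArg _ (finsum_mem_congr rfl fun s hs => by rw [hf s hs])

/-- The jump set is finite and does not depend on the integrand, so pointwise convergence suffices.
-/
theorem tendsto_pathIntegral (ha : IsCountingPath a) {t : ℝ≥0} {f : ℕ → ℝ≥0 → ℝ} {g : ℝ≥0 → ℝ}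
    (h : ∀ s ∈ Set.Ioc 0 t, Tendsto (fun k => f k s) atTop (𝓝 (g s))) :
    Tendsto (fun k => pathIntegral (f k) a t) atTop (𝓝 (pathIntegral g a t)) := by
  have key : ∀ f : ℝ≥0 → ℝ, pathIntegral f a t =
      ∑ s ∈ (ha.finite_jumps 0 t).toFinset, f s * jump a s := by
    intro f
    rw [pathIntegral]
    refine finsum_mem_eq_sum_of_inter_support_eq _ ?_
    ext s
    simp only [Set.mem_inter_iff, Function.mem_support, Set.Finite.coe_toFinset]
    constructor
    · exact fun hs => ⟨⟨hs.1, fun h => hs.2 (by rw [h, mul_zero])⟩, hs.2⟩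
    · exact fun hs => ⟨hs.1.1, hs.2⟩
  simp_rw [key]
  refine tendsto_finsetSum _ fun s hs => (h s ?_).mul_const _
  exact ((ha.finite_jumps 0 t).mem_toFinset.1 hs).1

end IsCountingPath
end RetrialQueue

/-! ### Sampling on a uniform grid -/

namespace RetrialQueue

/-- The `i`-th point of the partition of `[0,t]` into `k` intervals of equal length. -/
noncomputable def grid (t : ℝ≥0) (k i : ℕ) : ℝ≥0 := t * (i / k)

/-- The left-continuous step function taking the value `g (grid t k i)` on
`(grid t k i, grid t k (i + 1)]`. -/
noncomputable def sample (g : ℝ≥0 → ℝ) (t : ℝ≥0) (k : ℕ) (s : ℝ≥0) : ℝ :=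
  g (grid t k (⌈k * (s / t)⌉₊ - 1))

theorem grid_mono (t : ℝ≥0) (k : ℕ) : Monotone (grid t k) := by
  intro i j hij
  unfold grid
  gcongr

theorem grid_zero (t : ℝ≥0) (k : ℕ) : grid t k 0 = 0 := by simp [grid]

theorem grid_self (t : ℝ≥0) {k : ℕ} (hk : k ≠ 0) : grid t k k = t := by
  have : (k : ℝ≥0) ≠ 0 := by exact_mod_cast hk
  rw [grid, div_self this, mul_one]

theorem sample_eq_of_mem {t : ℝ≥0} (ht : t ≠ 0) {k : ℕ} (hk : k ≠ 0) (g : ℝ≥0 → ℝ) {i : ℕ}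
    {s : ℝ≥0} (hs : s ∈ Set.Ioc (grid t k i) (grid t k (i + 1))) :
    sample g t k s = g (grid t k i) := by
  have hk' : (0 : ℝ≥0) < k := by exact_mod_cast Nat.pos_of_ne_zero hk
  have ht' : 0 < t := pos_iff_ne_zero.2 ht
  have : ⌈(k : ℝ≥0) * (s / t)⌉₊ = i + 1 := by
    rw [Nat.ceil_eq_iff (Nat.succ_ne_zero i)]
    obtain ⟨h1, h2⟩ := hs
    simp only [grid] at h1 h2
    constructor
    · rw [Nat.succ_sub_one, mul_comm, ← div_lt_iff₀ hk', lt_div_iff₀ ht', mul_comm]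
      exact h1
    · rw [mul_comm, ← le_div_iff₀ hk', div_le_iff₀ ht', mul_comm]
      exact h2
  rw [sample, this, Nat.add_sub_cancel]

theorem measurable_sample (g : ℝ≥0 → ℝ) (t : ℝ≥0) (k : ℕ) : Measurable (sample g t k) := by
  have : Measurable fun m : ℕ => g (grid t k (m - 1)) := measurable_of_countable _
  exact this.comp (Nat.measurable_ceil.comp (by fun_prop))

/-- The sampling point lies within `t / k` of `s` and strictly below it; strictness is what makes
samples converge to the left limit, not to the value. -/
theorem tendsto_grid_ceil {t s : ℝ≥0} (hs : s ≠ 0) (hst : s ≤ t) :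
    Tendsto (fun k : ℕ => grid t k (⌈(k : ℝ≥0) * (s / t)⌉₊ - 1)) atTop (𝓝[<] s) := by
  have hs' : 0 < s := pos_iff_ne_zero.2 hs
  have ht' : 0 < t := hs'.trans_le hst
  have hbd : ∀ k : ℕ, k ≠ 0 → s - t / k ≤ grid t k (⌈(k : ℝ≥0) * (s / t)⌉₊ - 1) ∧
      grid t k (⌈(k : ℝ≥0) * (s / t)⌉₊ - 1) < s := by
    intro k hk
    have hk' : (0 : ℝ≥0) < k := by exact_mod_cast Nat.pos_of_ne_zero hk
    obtain ⟨i, hi⟩ : ∃ i, ⌈(k : ℝ≥0) * (s / t)⌉₊ = i + 1 :=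
      Nat.exists_eq_succ_of_ne_zero (Nat.ceil_pos.2 (by positivity)).ne'
    have h := (Nat.ceil_eq_iff (Nat.succ_ne_zero i)).1 hi
    rw [hi, Nat.add_sub_cancel]
    obtain ⟨h1, h2⟩ := h
    constructor
    · rw [mul_comm, ← le_div_iff₀ hk', div_le_iff₀ ht'] at h2
      rw [tsub_le_iff_right]
      refine h2.trans (le_of_eq ?_)
      rw [grid]
      push_cast
      ring
    · rw [Nat.succ_sub_one, mul_comm, ← div_lt_iff₀ hk', lt_div_iff₀ ht', mul_comm] at h1
      exact h1
  refine tendsto_nhdsWithin_iff.2 ⟨?_, ?_⟩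
  · have hlim : Tendsto (fun k : ℕ => s - t / k) atTop (𝓝 s) := by
      have : Tendsto (fun k : ℕ => t / (k : ℝ≥0)) atTop (𝓝 0) :=
        NNReal.tendsto_coe.1 (by simpa using tendsto_const_div_atTop_nhds_zero_nat (t : ℝ))
      simpa using tendsto_const_nhds.sub this
    refine tendsto_of_tendsto_of_tendsto_of_le_of_le' hlim tendsto_const_nhds ?_ ?_
    · filter_upwards [eventually_ne_atTop 0] with k hk using (hbd k hk).1
    · filter_upwards [eventually_ne_atTop 0] with k hk using (hbd k hk).2.le
  · filter_upwards [eventually_ne_atTop 0] with k hk using (hbd k hk).2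

theorem IsStep.tendsto_sample {g : ℝ≥0 → ℝ} (hg : IsStep g) {t s : ℝ≥0}
    (hs : s ∈ Set.Ioc 0 t) :
    Tendsto (fun k => sample g t k s) atTop (𝓝 (Function.leftLim g s)) :=
  tendsto_nhds_of_eventually_eq
    ((tendsto_grid_ceil hs.1.ne' hs.2).eventually (hg.eventually_eq_leftLim s))

theorem IsCountingPath.pathIntegral_sample {a : ℝ≥0 → ℕ} (ha : IsCountingPath a) (g : ℝ≥0 → ℝ)
    {t : ℝ≥0} (ht : t ≠ 0) {k : ℕ} (hk : k ≠ 0) :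
    pathIntegral (sample g t k) a t = ∑ i ∈ Finset.range k,
      g (grid t k i) * ((a (grid t k (i + 1)) : ℝ) - a (grid t k i)) := by
  -- The right endpoint is freed to run over the grid, so that induction applies.
  have h : ∀ j, pathIntegral (sample g t k) a (grid t k j) = ∑ i ∈ Finset.range j,
      g (grid t k i) * ((a (grid t k (i + 1)) : ℝ) - a (grid t k i)) := by
    intro j
    induction j with
    | zero => simp [grid_zero, pathIntegral]
    | succ j ih =>
      rw [Finset.sum_range_succ, ← ih]
      exact ha.pathIntegral_add_of_const (grid_mono t k j.le_succ)
        fun s hs => sample_eq_of_mem ht hk g hs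
  simpa [grid_self t hk] using h k

theorem toNNReal_mem_Ioc {u v : ℝ≥0} {s : ℝ} (hs : s ∈ Set.Ioc (u : ℝ) v) :
    s.toNNReal ∈ Set.Ioc u v :=
  ⟨Real.lt_toNNReal_iff_coe_lt.2 hs.1, Real.toNNReal_le_iff_le_coe.2 hs.2⟩

theorem measurable_sample_toNNReal (g : ℝ≥0 → ℝ) (t : ℝ≥0) (k : ℕ) :
    Measurable fun s : ℝ => sample g t k s.toNNReal :=
  (measurable_sample g t k).comp measurable_real_toNNReal

theorem intervalIntegrable_sample {g : ℝ≥0 → ℝ} {C : ℝ} (hC : ∀ s, |g s| ≤ C) (t : ℝ≥0) (k : ℕ)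
    (u v : ℝ) : IntervalIntegrable (fun s : ℝ => sample g t k s.toNNReal) volume u v := by
  refine (intervalIntegrable_const (c := C)).mono_fun
    (measurable_sample_toNNReal g t k).aestronglyMeasurable (ae_of_all _ fun s => ?_)
  exact (hC _).trans (le_abs_self C)

theorem integral_sample {g : ℝ≥0 → ℝ} {C : ℝ} (hC : ∀ s, |g s| ≤ C)
    {t : ℝ≥0} (ht : t ≠ 0) {k : ℕ} (hk : k ≠ 0) :
    ∫ s in (0 : ℝ)..t, sample g t k s.toNNReal = ∑ i ∈ Finset.range k,
      g (grid t k i) * ((grid t k (i + 1) : ℝ) - grid t k i) := by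
  have h := intervalIntegral.sum_integral_adjacent_intervals (n := k) (μ := volume)
    (a := fun i => (grid t k i : ℝ)) (f := fun s : ℝ => sample g t k s.toNNReal)
    fun i _ => intervalIntegrable_sample hC t k _ _
  simp only [grid_zero, grid_self t hk, NNReal.coe_zero] at h
  rw [← h]
  refine Finset.sum_congr rfl fun i _ => ?_
  have hle : (grid t k i : ℝ) ≤ grid t k (i + 1) := by exact_mod_cast grid_mono t k i.le_succ
  rw [intervalIntegral.integral_congr_ae (g := fun _ => g (grid t k i)),
    intervalIntegral.integral_const, smul_eq_mul, mul_comm]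
  refine ae_of_all _ fun s hs => ?_
  rw [Set.uIoc_of_le hle] at hs
  exact sample_eq_of_mem ht hk g (toNNReal_mem_Ioc hs)

namespace IsStep

variable {g : ℝ≥0 → ℝ}

theorem ae_leftLim_eq (hg : IsStep g) (t : ℝ≥0) :
    ∀ᵐ s : ℝ ∂volume.restrict (Set.Ioc 0 (t : ℝ)),
      Function.leftLim g s.toNNReal = g s.toNNReal := by
  rw [ae_restrict_iff' measurableSet_Ioc, ae_iff]
  -- Discontinuities are isolated: near `x` the exceptional set is contained in `{x}`.
  refine measure_null_of_locally_null _ fun x hx => ?_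
  have hx0 : 0 < x := by
    by_contra h
    exact hx fun hx' => absurd hx'.1 h
  have h1 : Tendsto Real.toNNReal (𝓝 x) (𝓝 x.toNNReal) := continuous_real_toNNReal.continuousAt
  have h2 := h1.eventually (eventually_nhdsWithin_iff.1 (hg.eventually_leftLim_eq x.toNNReal))
  refine ⟨_, inter_mem_nhdsWithin _ h2, measure_mono_null (t := {x}) ?_ (by simp)⟩
  rintro s ⟨hs, hs'⟩
  by_contra hne
  refine hs fun hs0 => hs' fun h => hne ?_
  exact (Real.toNNReal_eq_toNNReal_iff hs0.1.le hx0.le).1 h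

theorem ae_tendsto_sample (hg : IsStep g) (t : ℝ≥0) :
    ∀ᵐ s : ℝ ∂volume.restrict (Set.Ioc 0 (t : ℝ)),
      Tendsto (fun k => sample g t k s.toNNReal) atTop (𝓝 (g s.toNNReal)) := by
  filter_upwards [hg.ae_leftLim_eq t, ae_restrict_mem measurableSet_Ioc] with s h1 h2
  rw [← h1]
  exact hg.tendsto_sample (toNNReal_mem_Ioc (u := 0) (by simpa using h2))

theorem intervalIntegrable (hg : IsStep g) {C : ℝ} (hC : ∀ s, |g s| ≤ C) (t : ℝ≥0) :
    IntervalIntegrable (fun s : ℝ => g s.toNNReal) volume 0 t := by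
  rw [intervalIntegrable_iff_integrableOn_Ioc_of_le t.coe_nonneg]
  refine Integrable.mono' (g := fun _ => C) (integrable_const C) ?_
    (ae_of_all _ fun s => hC _)
  exact aestronglyMeasurable_of_tendsto_ae atTop
    (fun k => (measurable_sample_toNNReal g t k).aestronglyMeasurable) (hg.ae_tendsto_sample t)

theorem tendsto_integral_sample (hg : IsStep g) {C : ℝ} (hC : ∀ s, |g s| ≤ C) (t : ℝ≥0) :
    Tendsto (fun k => ∫ s in (0 : ℝ)..t, sample g t k s.toNNReal) atTop
      (𝓝 (∫ s in (0 : ℝ)..t, g s.toNNReal)) := by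
  simp only [intervalIntegral.integral_of_le t.coe_nonneg]
  exact tendsto_integral_of_dominated_convergence (fun _ => C)
    (fun k => (measurable_sample_toNNReal g t k).aestronglyMeasurable) (integrable_const C)
    (fun k => ae_of_all _ fun s => hC _) (hg.ae_tendsto_sample t)

end IsStep

theorem isStep_departures {n : ℕ} {p : Fin n → ℝ≥0 → ℕ} (hp : ∀ l, IsCountingPath (p l))
    (q₁ : ℝ≥0 → ℕ) : IsStep (departures p q₁) := by
  have : ∀ S : Finset (Fin n), IsStep fun t => ∑ l ∈ S,
      pathIntegral (fun s => if (l : ℕ) < Function.leftLim q₁ s then 1 else 0) (p l) t := by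
    intro S
    induction S using Finset.induction_on with
    | empty => simpa using (⟨fun _ => ⟨0, by simp⟩, by simp⟩ : IsStep fun _ => (0 : ℝ))
    | insert l S hl ih =>
      simp only [Finset.sum_insert hl]
      exact ((hp l).isStep_pathIntegral _).comp₂ ih (· + ·)
  exact this Finset.univ

/-- Path regularity of `q₁` is not assumed. The second equation makes `q₂ + q₃` a difference of path
integrals, hence a step function, and the balance equation then determines `q₁`. -/
theorem IsQueuePath.isStep_servers {n : ℕ} {a d : ℝ≥0 → ℕ} {p : Fin n → ℝ≥0 → ℕ}
    {q₁ q₂ q₃ : ℝ≥0 → ℕ} (ha : IsCountingPath a) (hd : IsCountingPath d)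
    (hp : ∀ l, IsCountingPath (p l)) (h : IsQueuePath a d p q₁ q₂ q₃) : IsStep q₁ := by
  have h23 : IsStep fun t => (q₂ t : ℝ) + q₃ t := by
    simp only [h.orbit_or_lost]
    exact (ha.isStep_pathIntegral _).comp₂ (hd.isStep_pathIntegral _) (· - ·)
  have h1 : IsStep fun t => (q₁ t : ℝ) := by
    have : ∀ t, (q₁ t : ℝ) = (a t : ℝ) - departures p q₁ t - (q₂ t + q₃ t) := fun t => by
      rw [← h.balance t]; ring
    simp only [this]
    exact ((ha.isStep.comp₂ (isStep_departures hp q₁) fun x y => (x : ℝ) - y)).comp₂ h23 (· - ·)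
  exact h1.of_comp_injective Nat.cast_injective

end RetrialQueue

/-! ### Moments of the Poisson law -/

namespace RetrialQueue

section Poisson

variable (r : ℝ≥0)

/-- The identity `n r^n / n! = r · r^(n-1) / (n-1)!` shifts the index. Taking `f = 1` and then `f n
= n` yields the first two moments. -/
theorem hasSum_poisson_mul_succ {f : ℕ → ℝ} {c : ℝ}
    (hf : HasSum (fun n : ℕ => Real.exp (-r) * r ^ n / n.factorial * f (n + 1)) c) :
    HasSum (fun n : ℕ => Real.exp (-r) * r ^ n / n.factorial * (n * f n)) (r * c) := by
  rw [← hasSum_nat_add_iff' 1]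
  simp only [Finset.range_one, Finset.sum_singleton, Nat.cast_zero, zero_mul, mul_zero, sub_zero]
  convert! hf.mul_left (r : ℝ) using 2 with n
  rw [Nat.factorial_succ, pow_succ]
  push_cast
  field_simp

theorem hasSum_poisson_one :
    HasSum (fun n : ℕ => Real.exp (-r) * r ^ n / n.factorial * (n : ℝ)) r := by
  have := hasSum_poisson_mul_succ r (f := fun _ => 1) (c := 1)
    (by simpa using hasSum_one_poissonMeasure r)
  simpa using this

theorem hasSum_poisson_sq :
    HasSum (fun n : ℕ => Real.exp (-r) * r ^ n / n.factorial * (n : ℝ) ^ 2) (r * (r + 1)) := by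
  have := hasSum_poisson_mul_succ r (f := fun n => n) (c := r + 1) ?_
  · simpa [sq] using this
  · have h := (hasSum_poisson_one r).add (hasSum_one_poissonMeasure r)
    convert! h using 2 with n
    push_cast
    ring

theorem memLp_two_poissonMeasure : MemLp (fun n : ℕ => (n : ℝ)) 2 (poissonMeasure r) := by
  rw [memLp_two_iff_integrable_sq .of_discrete, integrable_poissonMeasure_iff]
  simpa using (hasSum_poisson_sq r).summable

theorem integral_id_poissonMeasure : ∫ n : ℕ, (n : ℝ) ∂poissonMeasure r = r := by
  rw [integral_poissonMeasure]
  simpa using (hasSum_poisson_one r).tsum_eq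

theorem integral_sq_poissonMeasure :
    ∫ n : ℕ, (n : ℝ) ^ 2 ∂poissonMeasure r = r * (r + 1) := by
  rw [integral_poissonMeasure]
  simpa using (hasSum_poisson_sq r).tsum_eq

theorem integral_sq_sub_poissonMeasure :
    ∫ n : ℕ, ((n : ℝ) - r) ^ 2 ∂poissonMeasure r = r := by
  have h2 := (memLp_two_poissonMeasure r).integrable_sq
  have h1 := (memLp_two_poissonMeasure r).integrable one_le_two
  have : ∀ n : ℕ, ((n : ℝ) - r) ^ 2 = (n : ℝ) ^ 2 - 2 * r * n + r ^ 2 := fun n => by ring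
  simp only [this]
  have h3 : Integrable (fun n : ℕ => 2 * (r : ℝ) * n) (poissonMeasure r) := h1.const_mul _
  have h4 : Integrable (fun n : ℕ => (n : ℝ) ^ 2 - 2 * r * n) (poissonMeasure r) := h2.sub h3
  rw [integral_add h4 (integrable_const _), integral_sub h2 h3, integral_const_mul, integral_id_poissonMeasure,
    integral_sq_poissonMeasure]
  simp
  ring

end Poisson

/-! ### Compensated Poisson increments and orthogonality -/

variable {Ω : Type*} [mΩ : MeasurableSpace Ω] {P : Measure Ω}
  {𝓕 : Filtration ℝ≥0 mΩ} {μ : ℝ≥0} {N : ℝ≥0 → Ω → ℕ}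

/-- The centered increment of a Poisson process over `(s,t]`. -/
noncomputable def centeredIncrement (N : ℝ≥0 → Ω → ℕ) (μ s t : ℝ≥0) (ω : Ω) : ℝ :=
  ((N t ω - N s ω : ℕ) : ℝ) - (μ * (t - s) : ℝ≥0)

namespace IsPoissonProcess

theorem measurable_increment (hN : IsPoissonProcess P 𝓕 μ N) {s t : ℝ≥0} (hst : s ≤ t) :
    Measurable[𝓕 t] fun ω => N t ω - N s ω :=
  (hN.adapted t).sub ((hN.adapted s).mono (𝓕.mono hst) le_rfl)

theorem measurable_centeredIncrement (hN : IsPoissonProcess P 𝓕 μ N) {s t : ℝ≥0} (hst : s ≤ t) :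
    Measurable[𝓕 t] (centeredIncrement N μ s t) :=
  ((measurable_of_countable (fun n : ℕ => (n : ℝ))).comp (hN.measurable_increment hst)).sub_const _

theorem hasLaw_increment (hN : IsPoissonProcess P 𝓕 μ N) {s t : ℝ≥0} (hst : s ≤ t) :
    HasLaw (fun ω => N t ω - N s ω) (poissonMeasure (μ * (t - s))) P where
  aemeasurable := ((hN.measurable_increment hst).mono (𝓕.le t) le_rfl).aemeasurable
  map_eq := hN.increment_law s t hst

theorem memLp_centeredIncrement [IsProbabilityMeasure P] (hN : IsPoissonProcess P 𝓕 μ N)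
    {s t : ℝ≥0} (hst : s ≤ t) : MemLp (centeredIncrement N μ s t) 2 P := by
  refine MemLp.sub ?_ (memLp_const _)
  have h := memLp_two_poissonMeasure (μ * (t - s))
  rw [← hN.increment_law s t hst] at h
  exact h.comp_of_map (hN.hasLaw_increment hst).aemeasurable

theorem integral_centeredIncrement [IsProbabilityMeasure P] (hN : IsPoissonProcess P 𝓕 μ N)
    {s t : ℝ≥0} (hst : s ≤ t) : ∫ ω, centeredIncrement N μ s t ω ∂P = 0 := by
  have h := (hN.hasLaw_increment hst).integral_comp
    (f := fun n : ℕ => (n : ℝ) - (μ * (t - s) : ℝ≥0)) .of_discrete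
  refine h.trans ?_
  rw [integral_sub ((memLp_two_poissonMeasure _).integrable one_le_two) (integrable_const _),
    integral_id_poissonMeasure]
  simp

theorem integral_sq_centeredIncrement [IsProbabilityMeasure P] (hN : IsPoissonProcess P 𝓕 μ N)
    {s t : ℝ≥0} (hst : s ≤ t) : ∫ ω, centeredIncrement N μ s t ω ^ 2 ∂P = μ * ((t : ℝ) - s) := by
  have h := (hN.hasLaw_increment hst).integral_comp
    (f := fun n : ℕ => ((n : ℝ) - (μ * (t - s) : ℝ≥0)) ^ 2) .of_discrete
  refine h.trans ?_
  rw [integral_sq_sub_poissonMeasure]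
  push_cast [NNReal.coe_sub hst]
  rfl

theorem indepFun_centeredIncrement (hN : IsPoissonProcess P 𝓕 μ N) {s t : ℝ≥0} (hst : s ≤ t)
    {X : Ω → ℝ} (hX : Measurable[𝓕 s] X) : IndepFun X (centeredIncrement N μ s t) P := by
  rw [IndepFun_iff_Indep]
  refine indep_of_indep_of_le_left (indep_of_indep_of_le_right
    (hN.increment_indep s t hst).symm ?_) hX.comap_le
  have : centeredIncrement N μ s t =
    (fun n : ℕ => (n : ℝ) - (μ * (t - s) : ℝ≥0)) ∘ fun ω => N t ω - N s ω := rfl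
  rw [this, ← MeasurableSpace.comap_comp]
  exact MeasurableSpace.comap_mono le_top

/-- The second moment of the integral of a simple predictable process, bounded by one, against a
compensated Poisson process. -/
theorem integral_sq_sum_le [IsProbabilityMeasure P] (hN : IsPoissonProcess P 𝓕 μ N)
    {H : ℝ≥0 → Ω → ℝ} (hH : ∀ s, Measurable[𝓕 s] (H s)) (hH1 : ∀ s ω, |H s ω| ≤ 1) {τ : ℕ → ℝ≥0} (hτ : Monotone τ)
    (k : ℕ) :
    Measurable[𝓕 (τ k)] (fun ω => ∑ i ∈ Finset.range k,
      H (τ i) ω * centeredIncrement N μ (τ i) (τ (i + 1)) ω) ∧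
    MemLp (fun ω => ∑ i ∈ Finset.range k,
      H (τ i) ω * centeredIncrement N μ (τ i) (τ (i + 1)) ω) 2 P ∧
    ∫ ω, (∑ i ∈ Finset.range k,
      H (τ i) ω * centeredIncrement N μ (τ i) (τ (i + 1)) ω) ^ 2 ∂P ≤ μ * ((τ k : ℝ) - τ 0) := by
  -- The three claims go together: the cross term needs measurability and square integrability of
  -- the preceding partial sum.
  induction k with
  | zero => simp
  | succ k ih =>
    obtain ⟨hm, hL, hI⟩ := ih
    simp only [Finset.sum_range_succ]
    set S : Ω → ℝ := fun ω => ∑ i ∈ Finset.range k,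
      H (τ i) ω * centeredIncrement N μ (τ i) (τ (i + 1)) ω with hS
    set Z := centeredIncrement N μ (τ k) (τ (k + 1)) with hZ
    have hle : τ k ≤ τ (k + 1) := hτ k.le_succ
    have hZL : MemLp Z 2 P := hN.memLp_centeredIncrement hle
    have hHm : AEStronglyMeasurable (H (τ k)) P :=
      ((hH (τ k)).mono (𝓕.le _) le_rfl).aestronglyMeasurable
    have hHZm : Measurable[𝓕 (τ (k + 1))] fun ω => H (τ k) ω * Z ω :=
      ((hH (τ k)).mono (𝓕.mono hle) le_rfl).mul (hN.measurable_centeredIncrement hle)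
    have hHZ : ∀ ω, |H (τ k) ω * Z ω| ≤ |Z ω| := fun ω => by
      rw [abs_mul]
      exact mul_le_of_le_one_left (abs_nonneg _) (hH1 _ _)
    have hHZL : MemLp (fun ω => H (τ k) ω * Z ω) 2 P :=
      hZL.mono (hHZm.mono (𝓕.le _) le_rfl).aestronglyMeasurable (ae_of_all _ hHZ)
    refine ⟨(hm.mono (𝓕.mono hle) le_rfl).add hHZm, hL.add hHZL, ?_⟩
    -- `S * H (τ k)` is known at time `τ k`, hence independent of the centered increment `Z`.
    have hcross : ∫ ω, S ω * (H (τ k) ω * Z ω) ∂P = 0 := by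
      have := (hN.indepFun_centeredIncrement hle (hm.mul (hH (τ k)))).integral_fun_mul_eq_mul_integral
        ((hm.mul (hH (τ k))).mono (𝓕.le _) le_rfl).aestronglyMeasurable hZL.aestronglyMeasurable
      rw [hN.integral_centeredIncrement hle, mul_zero] at this
      rw [← this]
      exact integral_congr_ae (ae_of_all _ fun ω => (mul_assoc _ _ _).symm)
    have hsq : ∀ ω, (S ω + H (τ k) ω * Z ω) ^ 2 =
        S ω ^ 2 + 2 * (S ω * (H (τ k) ω * Z ω)) + (H (τ k) ω * Z ω) ^ 2 := fun ω => by ring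
    have hint : Integrable (fun ω => S ω * (H (τ k) ω * Z ω)) P := hL.integrable_mul hHZL
    have hlast : ∫ ω, (H (τ k) ω * Z ω) ^ 2 ∂P ≤ μ * ((τ (k + 1) : ℝ) - τ k) := by
      rw [← hN.integral_sq_centeredIncrement hle]
      exact integral_mono hHZL.integrable_sq hZL.integrable_sq fun ω => sq_le_sq.2 (hHZ ω)
    have hint' : Integrable (fun ω => S ω ^ 2 + 2 * (S ω * (H (τ k) ω * Z ω))) P :=
      hL.integrable_sq.add (hint.const_mul 2)
    rw [integral_congr_ae (ae_of_all _ hsq), integral_add hint' hHZL.integrable_sq,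
      integral_add hL.integrable_sq (hint.const_mul 2), integral_const_mul, hcross]
    linarith

end IsPoissonProcess
end RetrialQueue

/-! ### The compensated integral as a limit of grid sums -/

namespace RetrialQueue

variable {Ω : Type*} [mΩ : MeasurableSpace Ω] {P : Measure Ω}
  {𝓕 : Filtration ℝ≥0 mΩ} {μ : ℝ≥0} {N : ℝ≥0 → Ω → ℕ}

/-- The time integral is an almost sure limit of Riemann sums, which avoids joint measurability in
time and `ω`. -/
theorem aestronglyMeasurable_integral_of_isStep {g : ℝ≥0 → Ω → ℝ} (hg : ∀ s, Measurable (g s))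
    {C : ℝ} (hC : ∀ᵐ ω ∂P, ∀ s, |g s ω| ≤ C) (hstep : ∀ᵐ ω ∂P, IsStep fun s => g s ω) (t : ℝ≥0) :
    AEStronglyMeasurable (fun ω => ∫ s in (0 : ℝ)..t, g s.toNNReal ω) P := by
  rcases eq_or_ne t 0 with rfl | ht
  · simpa using aestronglyMeasurable_const
  refine aestronglyMeasurable_of_tendsto_ae atTop (f := fun k ω => ∑ i ∈ Finset.range k,
      g (grid t k i) ω * ((grid t k (i + 1) : ℝ) - grid t k i)) (fun k => ?_) ?_
  · exact (Finset.measurable_fun_sum _ fun i _ =>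
      (hg _).mul_const _).aestronglyMeasurable
  · filter_upwards [hC, hstep] with ω h1 h2
    refine (h2.tendsto_integral_sample h1 t).congr' ?_
    filter_upwards [eventually_ne_atTop 0] with k hk using integral_sample h1 ht hk

/-- The integral over `(0,t]` of the left limits of `H` against the compensated process
`N(t) - μ t`. -/
noncomputable def compensatedIntegral (H : ℝ≥0 → Ω → ℝ) (N : ℝ≥0 → Ω → ℕ) (μ t : ℝ≥0) (ω : Ω) :
    ℝ :=
  pathIntegral (Function.leftLim fun s => H s ω) (fun s => N s ω) t
    - μ * ∫ s in (0 : ℝ)..t, H s.toNNReal ω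

namespace IsPoissonProcess

variable {H : ℝ≥0 → Ω → ℝ}

/-- The same samples tend to the left limit at each jump of `N` and to `H` itself at almost every
time, which matches the two halves of the compensated integral. -/
theorem ae_tendsto_compensatedIntegral (hN : IsPoissonProcess P 𝓕 μ N)
    (hH1 : ∀ s ω, |H s ω| ≤ 1) (hstep : ∀ᵐ ω ∂P, IsStep fun s => H s ω) {t : ℝ≥0} (ht : t ≠ 0) :
    ∀ᵐ ω ∂P, Tendsto (fun k => ∑ i ∈ Finset.range k,
      H (grid t k i) ω * centeredIncrement N μ (grid t k i) (grid t k (i + 1)) ω) atTop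
      (𝓝 (compensatedIntegral H N μ t ω)) := by
  filter_upwards [hN.path, hstep] with ω h1 h2
  have hlim := (h1.tendsto_pathIntegral (t := t) fun s hs => h2.tendsto_sample hs).sub
    ((h2.tendsto_integral_sample (fun s => hH1 s ω) t).const_mul (μ : ℝ))
  refine hlim.congr' ?_
  filter_upwards [eventually_ne_atTop 0] with k hk
  rw [h1.pathIntegral_sample _ ht hk, integral_sample (fun s => hH1 s ω) ht hk, Finset.mul_sum,
    ← Finset.sum_sub_distrib]
  refine Finset.sum_congr rfl fun i _ => ?_
  have hle := grid_mono t k i.le_succ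
  rw [centeredIncrement, Nat.cast_sub (h1.mono hle), NNReal.coe_mul, NNReal.coe_sub hle]
  simp only [Nat.succ_eq_add_one]
  ring

theorem aemeasurable_compensatedIntegral [IsProbabilityMeasure P] (hN : IsPoissonProcess P 𝓕 μ N)
    (hH : ∀ s, Measurable[𝓕 s] (H s)) (hH1 : ∀ s ω, |H s ω| ≤ 1)
    (hstep : ∀ᵐ ω ∂P, IsStep fun s => H s ω) {t : ℝ≥0} (ht : t ≠ 0) :
    AEMeasurable (compensatedIntegral H N μ t) P :=
  aemeasurable_of_tendsto_metrizable_ae atTop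
    (fun k => ((hN.integral_sq_sum_le hH hH1 (grid_mono t k) k).1.mono (𝓕.le _) le_rfl).aemeasurable)
    (hN.ae_tendsto_compensatedIntegral hH1 hstep ht)

/-- Fatou's lemma needs only pathwise convergence of the grid sums, not convergence in `L²`. -/
theorem lintegral_sq_compensatedIntegral_le [IsProbabilityMeasure P]
    (hN : IsPoissonProcess P 𝓕 μ N)
    (hH : ∀ s, Measurable[𝓕 s] (H s)) (hH1 : ∀ s ω, |H s ω| ≤ 1)
    (hstep : ∀ᵐ ω ∂P, IsStep fun s => H s ω) {t : ℝ≥0} (ht : t ≠ 0) :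
    ∫⁻ ω, ENNReal.ofReal (compensatedIntegral H N μ t ω ^ 2) ∂P ≤ ENNReal.ofReal (μ * t) := by
  set S : ℕ → Ω → ℝ := fun k ω => ∑ i ∈ Finset.range k,
      H (grid t k i) ω * centeredIncrement N μ (grid t k i) (grid t k (i + 1)) ω with hS
  have hest := fun k => hN.integral_sq_sum_le hH hH1 (grid_mono t k) k
  have hlim : ∀ᵐ ω ∂P, ENNReal.ofReal (compensatedIntegral H N μ t ω ^ 2) =
      liminf (fun k => ENNReal.ofReal (S k ω ^ 2)) atTop := by
    filter_upwards [hN.ae_tendsto_compensatedIntegral hH1 hstep ht] with ω hω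
    exact ((ENNReal.continuous_ofReal.tendsto _).comp (hω.pow 2)).liminf_eq.symm
  rw [lintegral_congr_ae hlim]
  refine (lintegral_liminf_le fun k => ?_).trans ?_
  · exact (((hest k).1.mono (𝓕.le _) le_rfl).pow_const 2).ennreal_ofReal
  · refine liminf_le_of_frequently_le' (Eventually.frequently ?_)
    filter_upwards [eventually_ne_atTop 0] with k hk
    rw [← ofReal_integral_eq_lintegral_ofReal (hest k).2.1.integrable_sq
      (ae_of_all _ fun ω => sq_nonneg _)]
    refine ENNReal.ofReal_le_ofReal ((hest k).2.2.trans ?_)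
    simp [grid_self t hk, grid_zero]

theorem tendstoInMeasure_compensatedIntegral_div [IsProbabilityMeasure P]
    (hN : IsPoissonProcess P 𝓕 μ N)
    (hH : ∀ s, Measurable[𝓕 s] (H s)) (hH1 : ∀ s ω, |H s ω| ≤ 1)
    (hstep : ∀ᵐ ω ∂P, IsStep fun s => H s ω) :
    TendstoInMeasure P (fun (t : ℝ≥0) ω => compensatedIntegral H N μ t ω / t) atTop
      (fun _ => 0) := by
  rw [tendstoInMeasure_iff_norm]
  intro ε hε
  have hlim : Tendsto (fun t : ℝ≥0 => ENNReal.ofReal (μ / ε ^ 2 / t)) atTop (𝓝 0) := by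
    rw [← ENNReal.ofReal_zero]
    exact ENNReal.tendsto_ofReal (NNReal.tendsto_coe_atTop.2 tendsto_id |>.const_div_atTop _)
  refine tendsto_of_tendsto_of_tendsto_of_le_of_le' tendsto_const_nhds hlim
    (Eventually.of_forall fun _ => zero_le) ?_
  filter_upwards [eventually_ne_atTop 0] with t ht
  have ht' : (0 : ℝ) < t := NNReal.coe_pos.2 (pos_iff_ne_zero.2 ht)
  have hc : 0 < (ε * t) ^ 2 := by positivity
  -- Chebyshev: a second moment `μ t` against the threshold `(ε t) ^ 2`.
  calc P {ω | ε ≤ ‖compensatedIntegral H N μ t ω / t - 0‖}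
      ≤ P {ω | ENNReal.ofReal ((ε * t) ^ 2) ≤
          ENNReal.ofReal (compensatedIntegral H N μ t ω ^ 2)} := by
        refine measure_mono fun ω hω => ENNReal.ofReal_le_ofReal ?_
        have hω : ε ≤ ‖compensatedIntegral H N μ t ω / t - 0‖ := hω
        rw [sub_zero, Real.norm_eq_abs, abs_div, abs_of_pos ht', le_div_iff₀ ht'] at hω
        rw [← sq_abs (compensatedIntegral H N μ t ω)]
        gcongr
    _ ≤ (∫⁻ ω, ENNReal.ofReal (compensatedIntegral H N μ t ω ^ 2) ∂P) /
          ENNReal.ofReal ((ε * t) ^ 2) :=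
        meas_ge_le_lintegral_div
          ((hN.aemeasurable_compensatedIntegral hH hH1 hstep ht).pow_const 2).ennreal_ofReal
          (ENNReal.ofReal_pos.2 hc).ne' ENNReal.ofReal_ne_top
    _ ≤ ENNReal.ofReal (μ * t) / ENNReal.ofReal ((ε * t) ^ 2) := by
        gcongr
        exact hN.lintegral_sq_compensatedIntegral_le hH hH1 hstep ht
    _ = ENNReal.ofReal (μ / ε ^ 2 / t) := by
        rw [← ENNReal.ofReal_div_of_pos hc]
        congr 1
        field_simp

end IsPoissonProcess

/-! ### Convergence in probability -/

section Limits

variable {ι : Type*} {l : Filter ι} {u v w : ι → Ω → ℝ} {U V W : Ω → ℝ}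

/-- If the error in `w` is at least `ε`, one of the other two errors is at least `ε / (2 * C)`; a
union bound finishes. No measurability is required, so `X` may be arbitrary in the main theorem. -/
theorem tendstoInMeasure_of_le_mul_add {C : ℝ} (hC : 0 < C) (hu : TendstoInMeasure P u l U)
    (hv : TendstoInMeasure P v l V)
    (h : ∀ i, ∀ᵐ ω ∂P, |w i ω - W ω| ≤ C * (|u i ω - U ω| + |v i ω - V ω|)) :
    TendstoInMeasure P w l W := by
  rw [tendstoInMeasure_iff_norm] at *
  intro ε hε
  have hδ : 0 < ε / (2 * C) := by positivity
  have hlim := (hu _ hδ).add (hv _ hδ)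
  rw [add_zero] at hlim
  refine tendsto_of_tendsto_of_tendsto_of_le_of_le tendsto_const_nhds hlim
    (fun _ => zero_le) fun i => ?_
  refine le_trans (measure_mono_ae ?_) (measure_union_le _ _)
  filter_upwards [h i] with ω hω (hmem : ε ≤ |w i ω - W ω|)
  by_contra hnot
  have hnot : ¬ (ε / (2 * C) ≤ |u i ω - U ω| ∨ ε / (2 * C) ≤ |v i ω - V ω|) := hnot
  push Not at hnot
  have : C * (|u i ω - U ω| + |v i ω - V ω|) < C * (ε / (2 * C) + ε / (2 * C)) := by
    gcongr
    exacts [hnot.1, hnot.2]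
  have h2 : C * (ε / (2 * C) + ε / (2 * C)) = ε := by field_simp; ring
  linarith

theorem tendstoInMeasure_sum_zero {κ : Type*} (S : Finset κ) {f : κ → ι → Ω → ℝ}
    (hf : ∀ j, TendstoInMeasure P (f j) l fun _ => 0) :
    TendstoInMeasure P (fun i ω => ∑ j ∈ S, f j i ω) l fun _ => 0 := by
  classical
  induction S using Finset.induction_on with
  | empty =>
    rw [tendstoInMeasure_iff_norm]
    intro ε hε
    simp [hε.not_ge, tendsto_const_nhds]
  | insert j S hj ih =>
    refine tendstoInMeasure_of_le_mul_add one_pos (hf j) ih fun i => ae_of_all _ fun ω => ?_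
    simp only [Finset.sum_insert hj, sub_zero, one_mul]
    exact abs_add_le _ _

theorem tendstoInMeasure_of_ae_tendsto [IsFiniteMeasure P] [l.IsCountablyGenerated]
    (hu : ∀ i, AEStronglyMeasurable (u i) P)
    (h : ∀ᵐ ω ∂P, Tendsto (fun i => u i ω) l (𝓝 (U ω))) : TendstoInMeasure P u l U := by
  intro ε hε
  refine tendsto_of_seq_tendsto fun x hx => ?_
  exact tendstoInMeasure_of_tendsto_ae (fun k => hu (x k)) (h.mono fun ω hω => hω.comp hx) ε hε

/-- Every sequence of indices has a subsequence converging almost surely, to which dominated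
convergence applies. -/
theorem tendsto_integral_of_tendstoInMeasure_of_bounded [IsFiniteMeasure P]
    [l.IsCountablyGenerated] {C : ℝ} (hu : ∀ i, AEStronglyMeasurable (u i) P)
    (hC : ∀ i, ∀ᵐ ω ∂P, |u i ω| ≤ C) (h : TendstoInMeasure P u l U) :
    Tendsto (fun i => ∫ ω, u i ω ∂P) l (𝓝 (∫ ω, U ω ∂P)) := by
  refine tendsto_of_subseq_tendsto fun x hx => ?_
  obtain ⟨ms, -, hms⟩ := (h.comp hx).exists_seq_tendsto_ae
  exact ⟨ms, tendsto_integral_of_dominated_convergence (fun _ => C) (fun k => hu _)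
    (integrable_const C) (fun k => hC _) hms⟩

end Limits

end RetrialQueue

/-! ### Busy servers and the departure martingale -/

namespace RetrialQueue

section Servers

variable {Ω : Type*}

/-- The indicator that more than `l` servers are busy. -/
noncomputable def busyIndicator (Q₁ : ℝ≥0 → Ω → ℕ) (l : ℕ) (s : ℝ≥0) (ω : Ω) : ℝ :=
  if l < Q₁ s ω then 1 else 0

theorem abs_busyIndicator_le (Q₁ : ℝ≥0 → Ω → ℕ) (l : ℕ) (s : ℝ≥0) (ω : Ω) :
    |busyIndicator Q₁ l s ω| ≤ 1 := by
  unfold busyIndicator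
  split_ifs <;> simp

theorem sum_busyIndicator {n : ℕ} {Q₁ : ℝ≥0 → Ω → ℕ} {s : ℝ≥0} {ω : Ω} (h : Q₁ s ω ≤ n) :
    ∑ l : Fin n, busyIndicator Q₁ l s ω = Q₁ s ω := by
  simp only [busyIndicator]
  rw [Fin.sum_univ_eq_sum_range (fun l => if l < Q₁ s ω then (1 : ℝ) else 0) n,
    Finset.sum_ite, Finset.sum_const_zero, add_zero, Finset.sum_const, nsmul_one]
  congr 1
  have : (Finset.range n).filter (fun l => l < Q₁ s ω) = Finset.range (Q₁ s ω) := by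
    ext l
    simp only [Finset.mem_filter, Finset.mem_range]
    omega
  rw [this, Finset.card_range]

theorem isStep_busyIndicator {Q₁ : ℝ≥0 → Ω → ℕ} {ω : Ω} (h : IsStep fun s => Q₁ s ω) (l : ℕ) :
    IsStep fun s => busyIndicator Q₁ l s ω :=
  h.comp fun q => if l < q then (1 : ℝ) else 0

/-- The departure integrand, an indicator of the left limit of `Q₁`, is the left limit of the
indicator, and the indicators sum to `Q₁`. -/
theorem departures_sub_busyTime {n : ℕ} {π : Fin n → ℝ≥0 → Ω → ℕ} {Q₁ : ℝ≥0 → Ω → ℕ} {ω : Ω}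
    (hstep : IsStep fun s => Q₁ s ω) (hn : ∀ s, Q₁ s ω ≤ n) (μ t : ℝ≥0) :
    departures (fun l s => π l s ω) (fun s => Q₁ s ω) t - μ * busyTime Q₁ t ω =
      ∑ l : Fin n, compensatedIntegral (busyIndicator Q₁ l) (π l) μ t ω := by
  simp only [compensatedIntegral, Finset.sum_sub_distrib, ← Finset.mul_sum]
  congr 2
  · refine Finset.sum_congr rfl fun l _ => ?_
    congr 1
    funext s
    exact (hstep.leftLim_comp fun q => if (l : ℕ) < q then (1 : ℝ) else 0).symm
  · have h := intervalIntegral.integral_finsetSum (s := (Finset.univ : Finset (Fin n)))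
      (μ := volume) (a := 0) (b := (t : ℝ))
      (f := fun l s => busyIndicator Q₁ l s.toNNReal ω) fun l _ =>
      (isStep_busyIndicator hstep l).intervalIntegrable (fun s => abs_busyIndicator_le Q₁ l s ω) t
    rw [← h, busyTime]
    simp only [sum_busyIndicator (hn _)]

theorem abs_busyTime_le {n : ℕ} {Q₁ : ℝ≥0 → Ω → ℕ} {ω : Ω} (hn : ∀ s, Q₁ s ω ≤ n) (t : ℝ≥0) :
    |busyTime Q₁ t ω| ≤ n * t := by
  have := intervalIntegral.norm_integral_le_of_norm_le_const (a := 0) (b := (t : ℝ))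
    (f := fun s : ℝ => (Q₁ s.toNNReal ω : ℝ)) (C := n)
    fun s _ => by simpa using hn s.toNNReal
  simpa [busyTime, abs_of_nonneg t.coe_nonneg] using this

end Servers

end RetrialQueue

/-! ### The main theorem -/

open RetrialQueue in
theorem mainTheorem2 {Ω : Type*} [mΩ : MeasurableSpace Ω] (P : Measure Ω) [IsProbabilityMeasure P]
    (𝓕 : Filtration ℝ≥0 mΩ) (n : ℕ) (μ : ℝ≥0) (hμ : 0 < μ) (lam : ℝ)
    (A D : ℝ≥0 → Ω → ℕ) (π : Fin n → ℝ≥0 → Ω → ℕ) (Q₁ Q₂ Q₃ : ℝ≥0 → Ω → ℕ)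
    (hA : RetrialQueue.IsPointProcess P 𝓕 A)
    (hD : RetrialQueue.IsPointProcess P 𝓕 D)
    (hAD : RetrialQueue.NoCommonJumps P A D)
    (hπ : ∀ l, RetrialQueue.IsPoissonProcess P 𝓕 μ (π l))
    (hπ_indep : iIndepFun (fun l ω t => π l t ω) P)
    (hQ₁ : Adapted 𝓕 Q₁) (hQ₂ : Adapted 𝓕 Q₂) (hQ₃ : Adapted 𝓕 Q₃)
    (hQ : ∀ᵐ ω ∂P, RetrialQueue.IsQueuePath (fun t => A t ω) (fun t => D t ω)
      (fun l t => π l t ω) (fun t => Q₁ t ω) (fun t => Q₂ t ω) (fun t => Q₃ t ω))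
    (hlam : ∀ᵐ ω ∂P, Tendsto (fun t : ℝ≥0 => (A t ω : ℝ) / t) atTop (𝓝 lam)) :
    -- the busy time is a well-defined, integrable random variable
    (∀ᵐ ω ∂P, ∀ t : ℝ≥0,
      IntervalIntegrable (fun s : ℝ => (Q₁ s.toNNReal ω : ℝ)) volume 0 t) ∧
    (∀ t, Integrable (RetrialQueue.busyTime Q₁ t) P) ∧
    -- without any assumption on the existence of limits
    TendstoInMeasure P
      (fun (t : ℝ≥0) ω => (Q₃ t ω : ℝ) / t + μ * (RetrialQueue.busyTime Q₁ t ω / t))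
      atTop (fun _ => lam) ∧
    -- either limit in probability (possibly random) exists iff the other one does
    (∀ X : Ω → ℝ,
      TendstoInMeasure P (fun (t : ℝ≥0) ω => RetrialQueue.busyTime Q₁ t ω / t) atTop X ↔
      TendstoInMeasure P (fun (t : ℝ≥0) ω => (Q₃ t ω : ℝ) / t) atTop
        (fun ω => lam - μ * X ω)) ∧
    -- the loss rate, when it exists, in terms of the mean busy time
    (∀ loss : ℝ,
      TendstoInMeasure P (fun (t : ℝ≥0) ω => (Q₃ t ω : ℝ) / t) atTop (fun _ => loss) →
      ∃ m : ℝ,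
        TendstoInMeasure P (fun (t : ℝ≥0) ω => RetrialQueue.busyTime Q₁ t ω / t) atTop
          (fun _ => m) ∧
        Tendsto (fun t : ℝ≥0 => (∫ ω, RetrialQueue.busyTime Q₁ t ω ∂P) / t) atTop (𝓝 m) ∧
        loss = lam - μ * m) := by
  have hstep : ∀ᵐ ω ∂P, IsStep fun s => Q₁ s ω := by
    filter_upwards [hA.path, hD.path, ae_all_iff.2 fun l => (hπ l).path, hQ] with ω h1 h2 h3 h4
    exact h4.isStep_servers h1 h2 h3
  have hbd : ∀ᵐ ω ∂P, ∀ s, Q₁ s ω ≤ n := hQ.mono fun ω h => h.servers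
  have hbd' : ∀ᵐ ω ∂P, ∀ s, |(Q₁ s ω : ℝ)| ≤ n := hbd.mono fun ω h s => by simpa using h s
  have hmeas : ∀ t, AEStronglyMeasurable (busyTime Q₁ t) P :=
    aestronglyMeasurable_integral_of_isStep
      (fun s => (measurable_of_countable (fun q : ℕ => (q : ℝ))).comp ((hQ₁ s).mono (𝓕.le s) le_rfl))
      hbd' (hstep.mono fun ω h => h.comp fun q => (q : ℝ))
  have hμ' : (0 : ℝ) < μ := hμ
  have hcomp : TendstoInMeasure P (fun (t : ℝ≥0) ω =>
      ∑ l : Fin n, compensatedIntegral (busyIndicator Q₁ l) (π l) μ t ω / t) atTop fun _ => 0 :=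
    tendstoInMeasure_sum_zero _ fun l => (hπ l).tendstoInMeasure_compensatedIntegral_div
      (fun s => (measurable_of_countable (fun q : ℕ => if (l : ℕ) < q then (1 : ℝ) else 0)).comp
        (hQ₁ s)) (abs_busyIndicator_le Q₁ l) (hstep.mono fun ω h => isStep_busyIndicator h l)
  have harr : TendstoInMeasure P (fun (t : ℝ≥0) ω => (A t ω : ℝ) / t) atTop fun _ => lam :=
    tendstoInMeasure_of_ae_tendsto (fun t => (((measurable_of_countable (fun q : ℕ => (q : ℝ))).comp
      ((hA.adapted t).mono (𝓕.le t) le_rfl)).div_const _).aestronglyMeasurable) hlam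
  have hsmall : TendstoInMeasure P (fun (t : ℝ≥0) (_ : Ω) => ((n : ℝ) + 1) / t) atTop
      fun _ => 0 :=
    tendstoInMeasure_of_ae_tendsto (fun t => aestronglyMeasurable_const)
      (ae_of_all _ fun _ => (NNReal.tendsto_coe_atTop.2 tendsto_id).const_div_atTop _)
  have hmain : TendstoInMeasure P
      (fun (t : ℝ≥0) ω => (Q₃ t ω : ℝ) / t + μ * (busyTime Q₁ t ω / t)) atTop fun _ => lam := by
    have harr' : TendstoInMeasure P (fun (t : ℝ≥0) ω => (A t ω : ℝ) / t -
        ∑ l : Fin n, compensatedIntegral (busyIndicator Q₁ l) (π l) μ t ω / t) atTop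
        fun _ => lam :=
      tendstoInMeasure_of_le_mul_add one_pos harr hcomp fun t => ae_of_all _ fun ω => by
        rw [one_mul, sub_zero, sub_right_comm]
        exact abs_sub _ _
    refine tendstoInMeasure_of_le_mul_add one_pos harr' hsmall fun t => ?_
    filter_upwards [hQ, hstep] with ω h1 h2
    have hM := departures_sub_busyTime (π := π) h2 h1.servers μ t
    have hb := h1.balance t
    rw [← Finset.sum_div, ← hM, one_mul, sub_zero]
    have hq1 : (Q₁ t ω : ℝ) ≤ n := by exact_mod_cast h1.servers t
    have hq2 : (Q₂ t ω : ℝ) ≤ 1 := by exact_mod_cast h1.orbit t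
    have hle : |((Q₁ t ω : ℝ) + Q₂ t ω) / t| ≤ |((n : ℝ) + 1) / t| := by
      rw [abs_of_nonneg (by positivity), abs_of_nonneg (by positivity)]
      gcongr
    refine le_trans ?_ (add_le_add_right hle _)
    -- By the balance equation the error is that of `A/t - M/t` minus `(Q₁ + Q₂)/t`.
    refine le_trans (le_of_eq ?_) (abs_sub _ _)
    congr 1
    have : (Q₃ t ω : ℝ) = A t ω - departures (fun l t => π l t ω) (fun t => Q₁ t ω) t -
      (Q₁ t ω + Q₂ t ω) := by linarith
    rw [this]
    ring
  have hiff : ∀ X : Ω → ℝ,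
      TendstoInMeasure P (fun (t : ℝ≥0) ω => busyTime Q₁ t ω / t) atTop X ↔
      TendstoInMeasure P (fun (t : ℝ≥0) ω => (Q₃ t ω : ℝ) / t) atTop
        (fun ω => lam - μ * X ω) := by
    intro X
    constructor
    · intro h
      refine tendstoInMeasure_of_le_mul_add (C := 1 + μ) (by positivity) hmain h
        fun t => ae_of_all _ fun ω => ?_
      have e : (Q₃ t ω : ℝ) / t - (lam - μ * X ω) =
        ((Q₃ t ω : ℝ) / t + μ * (busyTime Q₁ t ω / t) - lam)
          - μ * (busyTime Q₁ t ω / t - X ω) := by ring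
      rw [e]
      refine (abs_sub _ _).trans ?_
      rw [abs_mul, abs_of_pos hμ']
      nlinarith [abs_nonneg ((Q₃ t ω : ℝ) / t + μ * (busyTime Q₁ t ω / t) - lam),
        abs_nonneg (busyTime Q₁ t ω / t - X ω)]
    · intro h
      refine tendstoInMeasure_of_le_mul_add (C := (μ : ℝ)⁻¹) (by positivity) hmain h
        fun t => ae_of_all _ fun ω => ?_
      have e : busyTime Q₁ t ω / t - X ω = (μ : ℝ)⁻¹ *
        (((Q₃ t ω : ℝ) / t + μ * (busyTime Q₁ t ω / t) - lam)
          - ((Q₃ t ω : ℝ) / t - (lam - μ * X ω))) := by field_simp; ring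
      rw [e, abs_mul, abs_of_pos (inv_pos.2 hμ')]
      gcongr
      exact abs_sub _ _
  refine ⟨?_, fun t => ?_, hmain, hiff, fun loss hloss => ?_⟩
  · filter_upwards [hstep, hbd'] with ω h1 h2 t
    exact (h1.comp fun q => (q : ℝ)).intervalIntegrable h2 t
  · exact Integrable.of_bound (hmeas t) (n * t) (hbd.mono fun ω h => abs_busyTime_le h t)
  -- The value of `m` is forced by solving `loss = lam - μ * m`.
  · have hm : loss = lam - μ * ((lam - loss) / μ) := by field_simp; ring
    have hbusy := (hiff fun _ => (lam - loss) / μ).2 (by rwa [← hm])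
    refine ⟨(lam - loss) / μ, hbusy, ?_, hm⟩
    have hmean := tendsto_integral_of_tendstoInMeasure_of_bounded (C := (n : ℝ))
      (fun t => by simpa only [div_eq_mul_inv] using (hmeas t).mul_const _)
      (fun t => hbd.mono fun ω h => ?_) hbusy
    · simpa [integral_div] using hmean
    · rw [abs_div, abs_of_nonneg t.coe_nonneg]
      -- This form of the bound also covers `t = 0`, where the quotient is `0`.
      exact div_le_of_le_mul₀ t.coe_nonneg n.cast_nonneg (abs_busyTime_le h t)
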